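/- All graphs are finite and simple. A graph is chordal if every induced cycle in it has length $3$, and, for a set $\mathcal S$ of graphs, a graph is $\mathcal S$-free if it contains no member of $\mathcal S$ as an induced subgraph. An $M_1$-partition of a graph $G$, where $$M_1=\begin{pmatrix}0&\ast&\ast\\ \ast&0&1\\ \ast&1&0\end{pmatrix},$$ is a partition $(V_1,V_2,V_3)$ of the vertex set, with parts allowed to be empty, such that $V_1$, $V_2$ and $V_3$ are independent sets and every vertex of $V_2$ is adjacent to every vertex of $V_3$. A minimal obstruction for $M_1$ is a graph that has no $M_1$-partition although each of its proper induced subgraphs has one. Let $\mathcal F=\{F_1,\dots,F_7\}\cup\mathcal F_1$, where - $F_1=K_3+K_2$ is the disjoint union of a triangle and an edge; - $F_2$ is the net, a triangle with one pendant vertex attached to each of its three vertices; - $F_3$ is a triangle with a pendant path of length $2$ attached to each of two of its vertices; - $F_4$ is the graph obtained from a path $a\,b\,c\,d$ by adding a vertex adjacent to $a,b,c,d$, a pendant vertex attached to $b$, and a pendant vertex attached to $c$; - $F_5$ is the $3$-sun, the graph obtained from a $6$-cycle $u_0u_1u_2u_3u_4u_5$ by adding the edges $u_1u_3$, $u_3u_5$,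 $u_5u_1$; - $F_6=P_6^2$ is the square of the path on $6$ vertices (two vertices are adjacent if their distance on the path is $1$ or $2$); - $F_7=K_4$; - $\mathcal F_1$ consists of the graphs obtained from a path with an odd number $k\ge 5$ of edges by adding one vertex adjacent to every vertex of the path except its two endpoints. **Theorem.** A chordal graph $G$ admits an $M_1$-partition if and only if it is $\mathcal F$-free. Moreover, $\mathcal F$ is, up to isomorphism, exactly the set of chordal minimal obstructions for $M_1$: a graph is both chordal and a minimal obstruction for $M_1$ if and only if it is isomorphic to a member of $\mathcal F$. -/

import Mathlib

namespace MatrixPartition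

/-- The three possible entries of a pattern: `0`, `1` and `∗`. -/
inductive Entry where
  | zero
  | one
  | star
  deriving DecidableEq

/-- `c : V → Fin m` encodes the ordered partition of the vertex set whose `i`-th part is the fibre
`V_i = {v | c v = i}` (parts may be empty). It is an `M`-partition if distinct vertices of `V_i`
and `V_j` (where `i = j` is allowed) are always non-adjacent when `M i j = 0`, and always adjacent
when `M i j = 1`. -/
def IsMPartition {V : Type*} {m : ℕ} (M : Matrix (Fin m) (Fin m) Entry) (G : SimpleGraph V)
    (c : V → Fin m) : Prop :=
  ∀ u v : V, u ≠ v →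
    (M (c u) (c v) = Entry.zero → ¬ G.Adj u v) ∧ (M (c u) (c v) = Entry.one → G.Adj u v)

/-- `G` admits an `M`-partition. -/
def IsMPartitionable {V : Type*} {m : ℕ} (M : Matrix (Fin m) (Fin m) Entry)
    (G : SimpleGraph V) : Prop :=
  ∃ c : V → Fin m, IsMPartition M G c

/-- `G` is a minimal obstruction for `M`: it has no `M`-partition, but every proper induced
subgraph has one. -/
def IsMinimalObstruction {V : Type*} {m : ℕ} (M : Matrix (Fin m) (Fin m) Entry)
    (G : SimpleGraph V) : Prop :=
  ¬ IsMPartitionable M G ∧ ∀ s : Set V, s ≠ Set.univ → IsMPartitionable M (G.induce s)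

/-- The pattern `M₁`, with rows `(0,∗,∗)`, `(∗,0,1)`, `(∗,1,0)`. -/
def M₁ : Matrix (Fin 3) (Fin 3) Entry :=
  !![Entry.zero, Entry.star, Entry.star;
     Entry.star, Entry.zero, Entry.one;
     Entry.star, Entry.one,  Entry.zero]

/-- A graph is chordal if all its induced cycles have length `3`. -/
def IsChordal {V : Type*} (G : SimpleGraph V) : Prop :=
  ∀ n : ℕ, 3 ≤ n → (SimpleGraph.cycleGraph n).IsIndContained G → n = 3

/-- The graph on `{0, …, n - 1}` with the listed edges. -/
def ofEdges (n : ℕ) (E : List (Fin n × Fin n)) : SimpleGraph (Fin n) :=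
  SimpleGraph.fromRel fun i j => (i, j) ∈ E

/-- Disjoint union of a triangle and an edge. -/
def F₁ : SimpleGraph (Fin 5) := ofEdges 5 [(0, 1), (1, 2), (0, 2), (3, 4)]

/-- The net: a triangle with a pendant vertex attached to each of its vertices. -/
def F₂ : SimpleGraph (Fin 6) := ofEdges 6 [(0, 1), (1, 2), (0, 2), (0, 3), (1, 4), (2, 5)]

/-- A triangle `0 1 2` with pendant paths of length `2`, `1 3 4` and `2 5 6`, attached at two of
its vertices. -/
def F₃ : SimpleGraph (Fin 7) :=
  ofEdges 7 [(0, 1), (1, 2), (0, 2), (1, 3), (3, 4), (2, 5), (5, 6)]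

/-- The path `6 1 2 5` together with a vertex `0` adjacent to all of its vertices, and pendant
vertices `3` and `4` attached to `1` and `2`. -/
def F₄ : SimpleGraph (Fin 7) :=
  ofEdges 7 [(6, 1), (1, 2), (2, 5), (0, 6), (0, 1), (0, 2), (0, 5), (1, 3), (2, 4)]

/-- The 3-sun: a 6-cycle `0 1 2 3 4 5` with the triangle `1 3 5` added. -/
def F₅ : SimpleGraph (Fin 6) :=
  ofEdges 6 [(0, 1), (1, 2), (2, 3), (3, 4), (4, 5), (5, 0), (1, 3), (3, 5), (5, 1)]

/-- The square of the path `0 1 2 3 4 5`. -/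
def F₆ : SimpleGraph (Fin 6) :=
  ofEdges 6 [(0, 1), (1, 2), (2, 3), (3, 4), (4, 5), (0, 2), (1, 3), (2, 4), (3, 5)]

/-- The complete graph on four vertices. -/
def F₇ : SimpleGraph (Fin 4) := ⊤

/-- The path `0 1 … k` of length `k` (on `k + 1` vertices), together with one extra vertex, `k + 1`,
adjacent to every vertex of the path except its two endpoints `0` and `k`. -/
def pathWithApex (k : ℕ) : SimpleGraph (Fin (k + 2)) :=
  SimpleGraph.fromRel fun i j =>
    (i.val + 1 = j.val ∧ j.val ≤ k) ∨ (0 < i.val ∧ i.val < k ∧ j.val = k + 1)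

/-- The infinite family: the graphs `pathWithApex k` with `k ≥ 5` odd. -/
def familyOne : Set (Σ n : ℕ, SimpleGraph (Fin n)) :=
  {H | ∃ k : ℕ, Odd k ∧ 5 ≤ k ∧ H = ⟨k + 2, pathWithApex k⟩}

/-- The family `ℱ`: the seven sporadic graphs and the infinite family. -/
def familyF : Set (Σ n : ℕ, SimpleGraph (Fin n)) :=
  {⟨5, F₁⟩, ⟨6, F₂⟩, ⟨7, F₃⟩, ⟨7, F₄⟩, ⟨6, F₅⟩, ⟨6, F₆⟩, ⟨4, F₇⟩} ∪ familyOne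

/-- `G` is `S`-free: no member of `S` is an induced subgraph of `G` (up to isomorphism). -/
def IsFree {V : Type*} (S : Set (Σ n : ℕ, SimpleGraph (Fin n))) (G : SimpleGraph V) : Prop :=
  ∀ H ∈ S, ¬ H.2.IsIndContained G

end MatrixPartition

namespace MatrixPartition

/-! The colours `0`, `1`, `2` stand for $V_1$, $V_2$, $V_3$. In a chordal graph one of $V_2$, $V_3$
has at most one vertex, since two non-adjacent vertices on each side would induce a 4-cycle. So a
chordal graph has an $M_1$-partition exactly when it is bipartite or becomes bipartite after
complementing the adjacencies between some vertex v and all others (`switchAt`).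

A non-bipartite graph has an induced odd cycle. Take one in `switchAt G v`. If it avoids v, it is an
induced odd cycle of G, hence a triangle missing v. If it passes through v, then according to its
length being 3, 5 or at least 7, it shows in G an edge far from v, a bull with nose v, or a member
of the infinite family. Hence it suffices to find a vertex in all triangles with no far edge and no
bull (`exists_centre`).

This is where the sporadic graphs enter. Triangles pairwise meet and then share a vertex
(`exists_meetsTriangles`). A far edge at one common vertex produces another with neither defect
(`exists_of_hasFarEdge`). If instead every common vertex were the nose of a bull, these bulls and
the triangles avoiding their sides would force a forbidden graph.

Conversely, every member of the family is a chordal minimal obstruction. A chordal minimal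
obstruction must contain some member, and by minimality is isomorphic to it. -/

/-- The vertices `g 0, …, g (n - 1)` form, in this cyclic order, an induced cycle of `G`. -/
def IsInducedCycleSeq {V : Type*} (G : SimpleGraph V) (n : ℕ) (g : ℕ → V) : Prop :=
  ∀ i j, i < j → j < n → g i ≠ g j ∧ (G.Adj (g i) (g j) ↔ j = i + 1 ∨ (i = 0 ∧ j + 1 = n))

/-- `g 0, …, g n = g 0` is a closed walk of `G`. -/
def IsClosedSeq {V : Type*} (G : SimpleGraph V) (n : ℕ) (g : ℕ → V) : Prop :=
  g 0 = g n ∧ ∀ i < n, G.Adj (g i) (g (i + 1))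

/-! ### Induced odd cycles and chordality -/

section OddCycle

variable {V : Type*} {G : SimpleGraph V}

theorem IsClosedSeq.segment {n : ℕ} {g : ℕ → V} (h : IsClosedSeq G n g) {i j : ℕ} (hij : i ≤ j)
    (hj : j ≤ n) (he : g i = g j) : IsClosedSeq G (j - i) (fun t => g (i + t)) := by
  refine ⟨?_, fun t ht => h.2 (i + t) (by omega)⟩
  simp only [Nat.add_zero, Nat.add_sub_cancel' hij, he]

theorem IsClosedSeq.shortcut {n : ℕ} {g : ℕ → V} (h : IsClosedSeq G n g) {i j : ℕ} (hij : i < j)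
    (hj : j ≤ n) (he : g i = g j) :
    IsClosedSeq G (n - (j - i)) (fun t => if t ≤ i then g t else g (t + (j - i))) := by
  refine ⟨?_, fun t ht => ?_⟩
  · by_cases hn : n - (j - i) ≤ i
    · obtain rfl : j = n := by omega
      have h2 : j - (j - i) = i := by omega
      simp only [h2, Nat.zero_le, le_refl, if_true, h.1, he]
    · simp only [Nat.zero_le, if_true, hn, if_false, h.1]
      congr 1
      omega
  · rcases lt_trichotomy t i with h1 | h1 | h1
    · simpa [show t ≤ i by omega, show t + 1 ≤ i by omega] using h.2 t (by omega)
    · subst h1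
      have := h.2 j (by omega)
      simp only [le_refl, if_true, show ¬ t + 1 ≤ t by omega, if_false, he]
      rwa [show t + 1 + (j - t) = j + 1 by omega]
    · have := h.2 (t + (j - i)) (by omega)
      simp only [show ¬ t ≤ i by omega, show ¬ t + 1 ≤ i by omega, if_false]
      rwa [show t + 1 + (j - i) = t + (j - i) + 1 by omega]

theorem IsClosedSeq.chord_segment {n : ℕ} {g : ℕ → V} (h : IsClosedSeq G n g) {i j : ℕ}
    (hij : i < j) (hj : j ≤ n) (he : G.Adj (g j) (g i)) :
    IsClosedSeq G (j - i + 1) (fun t => if t ≤ j - i then g (i + t) else g i) := by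
  refine ⟨by simp, fun t ht => ?_⟩
  by_cases h1 : t = j - i
  · subst h1
    simpa [show i + (j - i) = j by omega] using he
  · simpa [show t ≤ j - i by omega, show t + 1 ≤ j - i by omega, Nat.add_assoc]
      using h.2 (i + t) (by omega)

theorem IsClosedSeq.chord_shortcut {n : ℕ} {g : ℕ → V} (h : IsClosedSeq G n g) {i j : ℕ}
    (hij : i < j) (hj : j ≤ n) (he : G.Adj (g i) (g j)) :
    IsClosedSeq G (n - (j - i) + 1) (fun t => if t ≤ i then g t else g (t + (j - i) - 1)) := by
  refine ⟨?_, fun t ht => ?_⟩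
  · simp only [Nat.zero_le, if_true, show ¬ n - (j - i) + 1 ≤ i by omega, if_false, h.1]
    congr 1
    omega
  · rcases lt_trichotomy t i with h1 | h1 | h1
    · simpa [show t ≤ i by omega, show t + 1 ≤ i by omega] using h.2 t (by omega)
    · subst h1
      simp only [le_refl, if_true, show ¬ t + 1 ≤ t by omega, if_false]
      rwa [show t + 1 + (j - t) - 1 = j by omega]
    · have := h.2 (t + (j - i) - 1) (by omega)
      simp only [show ¬ t ≤ i by omega, show ¬ t + 1 ≤ i by omega, if_false]
      rwa [show t + 1 + (j - i) - 1 = t + (j - i) - 1 + 1 by omega]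

/-- A graph that is not 2-colourable contains an induced odd cycle. -/
theorem exists_odd_isInducedCycleSeq (h : ¬ G.Colorable 2) :
    ∃ n g, Odd n ∧ 3 ≤ n ∧ IsInducedCycleSeq G n g := by
  have hex : ∃ n, Odd n ∧ ∃ g, IsClosedSeq G n g := by
    rw [SimpleGraph.two_colorable_iff_forall_loop_even] at h
    push Not at h
    obtain ⟨u, w, hw⟩ := h
    refine ⟨w.length, by simpa using hw, w.getVert, by simp, fun i hi => ?_⟩
    exact w.adj_getVert_succ hi
  classical
  obtain ⟨hodd, g, hg⟩ := Nat.find_spec hex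
  have hmin : ∀ m, m < Nat.find hex → Odd m → ∀ f, ¬ IsClosedSeq G m f :=
    fun m hm ho f hf => Nat.find_min hex hm ⟨ho, f, hf⟩
  generalize Nat.find hex = n at hodd hg hmin
  -- A repeated vertex or a chord splits the shortest odd closed walk into two shorter closed walks
  -- of total length `n` or `n + 2`. The total is odd, so one of the two is odd.
  refine ⟨n, g, hodd, ?_, fun i j hij hj => ⟨fun he => ?_, fun ha => ?_, fun ha => ?_⟩⟩
  · by_contra hlt
    obtain rfl : n = 1 := by
      obtain ⟨k, rfl⟩ := hodd
      omega
    have := hg.2 0 (by omega)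
    rw [hg.1] at this
    exact G.irrefl this
  · rcases Nat.even_or_odd (j - i) with hp | hp
    · exact hmin _ (by omega) (by grind) _ (hg.shortcut hij hj.le he)
    · exact hmin _ (by omega) hp _ (hg.segment hij.le hj.le he)
  · by_contra hcon
    rcases Nat.even_or_odd (j - i) with hp | hp
    · exact hmin _ (by omega) (by grind) _ (hg.chord_segment hij hj.le ha.symm)
    · exact hmin _ (by omega) (by grind) _ (hg.chord_shortcut hij hj.le ha)
  · rcases ha with rfl | ⟨rfl, rfl⟩
    · exact hg.2 i (by omega)
    · rw [hg.1]
      exact (hg.2 j (by omega)).symm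

theorem IsInducedCycleSeq.rotate {n : ℕ} {g : ℕ → V} (h : IsInducedCycleSeq G n g) {m : ℕ}
    (hm : m < n) : IsInducedCycleSeq G n (fun i => g ((i + m) % n)) := by
  intro i j hij hj
  have key : ∀ i < n, (i + m) % n = if i + m < n then i + m else i + m - n := by
    intro i hi
    split_ifs with h1
    · exact Nat.mod_eq_of_lt h1
    · rw [Nat.mod_eq_sub_mod (by omega), Nat.mod_eq_of_lt (by omega)]
  simp only [key i (by omega), key j hj]
  split_ifs with h1 h2 h2
  · have := h (i + m) (j + m) (by omega) h2
    refine ⟨this.1, this.2.trans ?_⟩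
    omega
  · have := h (j + m - n) (i + m) (by omega) (by omega)
    refine ⟨this.1.symm, (SimpleGraph.adj_comm _ _ _).trans (this.2.trans ?_)⟩
    omega
  · omega
  · have := h (i + m - n) (j + m - n) (by omega) (by omega)
    refine ⟨this.1, this.2.trans ?_⟩
    omega

theorem IsInducedCycleSeq.isIndContained {n : ℕ} {g : ℕ → V} (h : IsInducedCycleSeq G n g) :
    (SimpleGraph.cycleGraph n).IsIndContained G := by
  have hinj : Function.Injective fun i : Fin n => g i.val := by
    intro i j hij
    rcases lt_trichotomy i.val j.val with h1 | h1 | h1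
    · exact absurd hij (h _ _ h1 j.2).1
    · exact Fin.ext h1
    · exact absurd hij.symm (h _ _ h1 i.2).1
  have aux : ∀ i j : Fin n, i < j →
      (G.Adj (g i) (g j) ↔ (SimpleGraph.cycleGraph n).Adj i j) := by
    intro i j hij
    rw [(h i j hij j.2).2, SimpleGraph.cycleGraph_adj', Fin.sub_val_of_le hij.le,
      Fin.coe_sub_iff_lt.2 hij]
    have := j.2
    have : i.val < j.val := hij
    omega
  refine ⟨⟨⟨_, hinj⟩, fun {i j} => ?_⟩⟩
  rcases lt_trichotomy i j with h1 | rfl | h1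
  · exact aux i j h1
  · simp
  · rw [SimpleGraph.adj_comm, SimpleGraph.adj_comm (SimpleGraph.cycleGraph n)]
    exact aux j i h1

/-- A chordal graph has no induced cycle of length at least `4`. -/
theorem IsChordal.eq_three (hG : IsChordal G) {n : ℕ} (hn : 3 ≤ n) {g : ℕ → V}
    (h : IsInducedCycleSeq G n g) : n = 3 :=
  hG n hn h.isIndContained

open scoped Fin.CommRing in
/-- A graph with a perfect elimination ordering is chordal. -/
theorem isChordal_of_elimination (r : V → ℕ)
    (hr : ∀ v x y, G.Adj v x → G.Adj v y → r v ≤ r x → r v ≤ r y → x ≠ y → G.Adj x y) :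
    IsChordal G := by
  rintro n hn ⟨f⟩
  obtain ⟨m, rfl⟩ : ∃ m, n = m + 3 := ⟨n - 3, by omega⟩
  obtain ⟨v, hv⟩ := Finite.exists_min fun i => r (f i)
  have h1 : (SimpleGraph.cycleGraph (m + 3)).Adj v (v + 1) := by
    simp [SimpleGraph.cycleGraph_adj]
  have h2 : (SimpleGraph.cycleGraph (m + 3)).Adj v (v - 1) := by
    simp [SimpleGraph.cycleGraph_adj]
  have hne : v + 1 ≠ v - 1 := by
    intro h
    have h4 : (1 : Fin (m + 3)) + 1 = 0 := by linear_combination h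
    rw [Fin.ext_iff, Fin.val_add, Fin.val_one, Nat.mod_eq_of_lt (by omega)] at h4
    exact absurd h4 (by simp)
  have h3 := hr _ _ _ (f.map_rel_iff.2 h1) (f.map_rel_iff.2 h2) (hv _) (hv _)
    (fun h => hne (f.injective h))
  rw [SimpleGraph.Embedding.map_adj_iff, SimpleGraph.cycleGraph_adj] at h3
  -- The two cycle-neighbours of the vertex of least rank are adjacent, which modulo `m + 3` means
  -- `1 = 0` or `3 = 0`.
  by_contra hm
  rcases h3 with h3 | h3
  · have h4 : (1 : Fin (m + 3)) = 0 := by linear_combination h3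
    rw [Fin.ext_iff, Fin.val_one] at h4
    exact absurd h4 (by simp)
  · have h4 : (1 : Fin (m + 3)) + 1 + 1 = 0 := by linear_combination -h3
    rw [Fin.ext_iff, Fin.val_add, Fin.val_add, Fin.val_one, Nat.mod_eq_of_lt (a := 1 + 1) (by omega),
      Nat.mod_eq_of_lt (by omega)] at h4
    exact absurd h4 (by simp)

end OddCycle

/-! ### Partitions, embeddings and minimality -/

section Patterns

variable {V W : Type*} {G : SimpleGraph V} {H : SimpleGraph W}

/-- The constraint that `M₁` puts on the parts `x`, `y` of two distinct vertices, which are adjacent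
or not according to `p`. -/
def Compatible (p : Prop) (x y : Fin 3) : Prop :=
  (p → x ≠ y) ∧ (¬ p → x = y ∨ x = 0 ∨ y = 0)

instance (p : Prop) [Decidable p] (x y : Fin 3) : Decidable (Compatible p x y) :=
  inferInstanceAs (Decidable (_ ∧ _))

theorem M₁_entry (x y : Fin 3) :
    (M₁ x y = Entry.zero ↔ x = y) ∧ (M₁ x y = Entry.one ↔ ¬ (x = y ∨ x = 0 ∨ y = 0)) := by
  fin_cases x <;> fin_cases y <;> simp [M₁]

theorem isMPartition_M₁_iff {c : V → Fin 3} :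
    IsMPartition M₁ G c ↔ ∀ u v, u ≠ v → Compatible (G.Adj u v) (c u) (c v) := by
  unfold IsMPartition Compatible
  simp only [M₁_entry]
  refine forall₃_congr fun u v _ => ?_
  tauto

theorem IsMPartitionable.of_embedding (f : H ↪g G) (h : IsMPartitionable M₁ G) :
    IsMPartitionable M₁ H := by
  obtain ⟨c, hc⟩ := h
  rw [isMPartition_M₁_iff] at hc
  refine ⟨c ∘ f, isMPartition_M₁_iff.2 fun u v huv => ?_⟩
  simpa using hc (f u) (f v) (f.injective.ne huv)

theorem IsChordal.of_embedding (f : H ↪g G) (h : IsChordal G) : IsChordal H :=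
  fun n hn hc => h n hn (hc.trans ⟨f⟩)

theorem IsMinimalObstruction.of_iso (e : G ≃g H) (h : IsMinimalObstruction M₁ H) :
    IsMinimalObstruction M₁ G := by
  refine ⟨fun hG => h.1 (hG.of_embedding e.symm.toEmbedding), fun s hs => ?_⟩
  have hs' : e '' s ≠ Set.univ := by
    intro hu
    apply hs
    rw [← Set.preimage_image_eq s e.injective, hu, Set.preimage_univ]
  refine (h.2 _ hs').of_embedding ⟨⟨fun x => ⟨e x, x, x.2, rfl⟩, fun x y hxy => ?_⟩, ?_⟩
  · simpa [Subtype.ext_iff] using hxy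
  · exact e.map_rel_iff

/-- Every proper induced subgraph lies in some G − w, so it is enough to partition the
vertex-deleted subgraphs; the value `c w w` is irrelevant. -/
theorem isMinimalObstruction_of_forall_deletion (h : ¬ IsMPartitionable M₁ G) (c : V → V → Fin 3)
    (hc : ∀ w u v, u ≠ w → v ≠ w → u ≠ v → Compatible (G.Adj u v) (c w u) (c w v)) :
    IsMinimalObstruction M₁ G := by
  refine ⟨h, fun s hs => ?_⟩
  obtain ⟨w, hw⟩ := (Set.ne_univ_iff_exists_notMem s).1 hs
  refine ⟨fun u => c w u, isMPartition_M₁_iff.2 fun u v huv => ?_⟩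
  exact hc w u v (fun h => hw (h ▸ u.2)) (fun h => hw (h ▸ v.2)) (fun h => huv (Subtype.ext h))

/-- A minimal obstruction is isomorphic to each obstruction it contains as an induced subgraph. -/
theorem IsMinimalObstruction.nonempty_iso (h : IsMinimalObstruction M₁ G)
    (hH : ¬ IsMPartitionable M₁ H) (hHG : H.IsIndContained G) : Nonempty (G ≃g H) := by
  obtain ⟨f⟩ := hHG
  have hr : Set.range f = Set.univ := by
    by_contra hne
    refine hH ((h.2 _ hne).of_embedding ⟨⟨fun x => ⟨f x, x, rfl⟩, fun x y hxy => ?_⟩, ?_⟩)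
    · simpa [Subtype.ext_iff] using hxy
    · exact f.map_rel_iff
  exact ⟨(RelIso.ofSurjective f (Set.range_eq_univ.1 hr)).symm⟩

end Patterns

/-! ### The sporadic obstructions, by computation -/

instance (n : ℕ) (E : List (Fin n × Fin n)) : DecidableRel (ofEdges n E).Adj :=
  inferInstanceAs (DecidableRel (SimpleGraph.fromRel fun i j => (i, j) ∈ E).Adj)

instance : DecidableRel F₁.Adj := inferInstanceAs (DecidableRel (ofEdges _ _).Adj)
instance : DecidableRel F₂.Adj := inferInstanceAs (DecidableRel (ofEdges _ _).Adj)
instance : DecidableRel F₃.Adj := inferInstanceAs (DecidableRel (ofEdges _ _).Adj)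
instance : DecidableRel F₄.Adj := inferInstanceAs (DecidableRel (ofEdges _ _).Adj)
instance : DecidableRel F₅.Adj := inferInstanceAs (DecidableRel (ofEdges _ _).Adj)
instance : DecidableRel F₆.Adj := inferInstanceAs (DecidableRel (ofEdges _ _).Adj)
instance : DecidableRel F₇.Adj := inferInstanceAs (DecidableRel (⊤ : SimpleGraph (Fin 4)).Adj)

/-- Backtracking search: no colouring of the vertices in `l` is compatible with `H` and with the
colours already chosen in `done`. -/
def stuck {n : ℕ} (H : SimpleGraph (Fin n)) [DecidableRel H.Adj] :
    List (Fin n) → List (Fin n × Fin 3) → Bool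
  | [], _ => false
  | v :: l, done => [0, 1, 2].all fun a =>
      (done.any fun p => !decide (Compatible (H.Adj p.1 v) p.2 a)) || stuck H l ((v, a) :: done)

/-- Soundness of the search: given a valid partition `x`, the branch that always picks the colour `x
v` never meets a conflict. -/
theorem stuck_eq_false {n : ℕ} {H : SimpleGraph (Fin n)} [DecidableRel H.Adj] {x : Fin n → Fin 3}
    (hx : ∀ u v, u ≠ v → Compatible (H.Adj u v) (x u) (x v)) (l : List (Fin n)) :
    ∀ done : List (Fin n × Fin 3), l.Nodup → (∀ p ∈ done, p.2 = x p.1 ∧ p.1 ∉ l) →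
      stuck H l done = false := by
  induction l with
  | nil => exact fun _ _ _ => rfl
  | cons v l ih =>
    intro done hl hd
    rw [List.nodup_cons] at hl
    rw [stuck, List.all_eq_false]
    refine ⟨x v, by generalize x v = a; revert a; decide, ?_⟩
    rw [Bool.not_eq_true, Bool.or_eq_false_iff]
    constructor
    · rw [List.any_eq_false]
      intro p hp
      obtain ⟨h1, h2⟩ := hd p hp
      have h3 : p.1 ≠ v := fun h => h2 (h ▸ List.mem_cons_self)
      simpa [h1] using hx p.1 v h3
    · refine ih _ hl.2 fun p hp => ?_
      rcases List.mem_cons.1 hp with rfl | hp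
      · exact ⟨rfl, hl.1⟩
      · exact ⟨(hd p hp).1, fun h => (hd p hp).2 (List.mem_cons_of_mem _ h)⟩

/-- A certificate, checkable by computation, for a chordal minimal obstruction: an elimination
ordering `r`, the failure of all colourings, and a colouring `c w` of each `H - w`. -/
theorem isChordal_and_isMinimalObstruction {n : ℕ} {H : SimpleGraph (Fin n)} [DecidableRel H.Adj]
    (r : Fin n → ℕ) (c : Fin n → Fin n → Fin 3)
    (hr : ∀ v x y, H.Adj v x → H.Adj v y → r v ≤ r x → r v ≤ r y → x ≠ y → H.Adj x y)
    (hH : stuck H (List.finRange n) [] = true)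
    (hc : ∀ w u v, u ≠ w → v ≠ w → u ≠ v → Compatible (H.Adj u v) (c w u) (c w v)) :
    IsChordal H ∧ IsMinimalObstruction M₁ H := by
  refine ⟨isChordal_of_elimination r hr, isMinimalObstruction_of_forall_deletion ?_ c hc⟩
  rintro ⟨x, hx⟩
  have := stuck_eq_false (isMPartition_M₁_iff.1 hx) _ [] (List.nodup_finRange n) (by simp)
  simp [hH] at this

theorem F₁_obstruction : IsChordal F₁ ∧ IsMinimalObstruction M₁ F₁ :=
  isChordal_and_isMinimalObstruction ![0, 1, 2, 3, 4]
    ![![0, 0, 1, 0, 1], ![0, 0, 1, 0, 1], ![0, 1, 0, 0, 1], ![0, 1, 2, 0, 0],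
      ![0, 1, 2, 0, 0]]
    (by decide +kernel) (by decide +kernel) (by decide +kernel)

theorem F₂_obstruction : IsChordal F₂ ∧ IsMinimalObstruction M₁ F₂ :=
  isChordal_and_isMinimalObstruction ![1, 3, 4, 0, 2, 5]
    ![![0, 0, 1, 0, 1, 0], ![0, 0, 1, 1, 0, 0], ![0, 1, 0, 1, 0, 0],
      ![0, 1, 2, 0, 0, 0], ![1, 0, 2, 0, 0, 0], ![1, 2, 0, 0, 0, 0]]
    (by decide +kernel) (by decide +kernel) (by decide +kernel)

theorem F₃_obstruction : IsChordal F₃ ∧ IsMinimalObstruction M₁ F₃ :=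
  isChordal_and_isMinimalObstruction ![0, 3, 4, 2, 1, 5, 6]
    ![![0, 0, 1, 1, 0, 0, 1], ![0, 0, 1, 0, 1, 0, 1], ![0, 1, 0, 0, 1, 0, 1],
      ![0, 1, 2, 0, 0, 1, 0], ![0, 1, 2, 0, 0, 1, 0], ![0, 1, 2, 2, 0, 0, 0],
      ![0, 1, 2, 2, 0, 0, 0]]
    (by decide +kernel) (by decide +kernel) (by decide +kernel)

theorem F₄_obstruction : IsChordal F₄ ∧ IsMinimalObstruction M₁ F₄ :=
  isChordal_and_isMinimalObstruction ![2, 4, 5, 3, 6, 0, 1]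
    ![![0, 0, 1, 1, 0, 0, 1], ![1, 0, 2, 0, 0, 0, 0], ![1, 2, 0, 0, 0, 0, 0],
      ![1, 0, 2, 0, 0, 0, 2], ![1, 2, 0, 0, 0, 2, 0], ![0, 1, 2, 0, 0, 0, 2],
      ![0, 1, 2, 0, 0, 1, 0]]
    (by decide +kernel) (by decide +kernel) (by decide +kernel)

theorem F₅_obstruction : IsChordal F₅ ∧ IsMinimalObstruction M₁ F₅ :=
  isChordal_and_isMinimalObstruction ![0, 2, 1, 3, 4, 5]
    ![![0, 0, 1, 2, 0, 1], ![0, 0, 0, 1, 0, 2], ![0, 1, 0, 0, 1, 2],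
      ![0, 1, 0, 0, 0, 2], ![0, 1, 2, 0, 0, 2], ![0, 1, 0, 2, 0, 0]]
    (by decide +kernel) (by decide +kernel) (by decide +kernel)

theorem F₆_obstruction : IsChordal F₆ ∧ IsMinimalObstruction M₁ F₆ :=
  isChordal_and_isMinimalObstruction ![0, 1, 2, 3, 4, 5]
    ![![0, 0, 1, 2, 0, 1], ![0, 0, 1, 0, 2, 1], ![0, 1, 0, 2, 0, 1],
      ![0, 1, 2, 0, 1, 0], ![1, 0, 2, 1, 0, 0], ![0, 1, 2, 0, 1, 0]]
    (by decide +kernel) (by decide +kernel) (by decide +kernel)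

theorem F₇_obstruction : IsChordal F₇ ∧ IsMinimalObstruction M₁ F₇ :=
  isChordal_and_isMinimalObstruction ![0, 1, 2, 3]
    ![![0, 0, 1, 2], ![0, 0, 1, 2], ![0, 1, 0, 2], ![0, 1, 2, 0]]
    (by decide +kernel) (by decide +kernel) (by decide +kernel)

/-! ### The infinite family -/

theorem pathWithApex_adj {k : ℕ} {i j : Fin (k + 2)} :
    (pathWithApex k).Adj i j ↔ i.val ≠ j.val ∧
      (((i.val + 1 = j.val ∧ j.val ≤ k) ∨ (0 < i.val ∧ i.val < k ∧ j.val = k + 1)) ∨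
        ((j.val + 1 = i.val ∧ i.val ≤ k) ∨ (0 < j.val ∧ j.val < k ∧ i.val = k + 1))) := by
  simp [pathWithApex, Fin.ext_iff]

theorem isChordal_pathWithApex (k : ℕ) : IsChordal (pathWithApex k) := by
  -- Eliminate both endpoints, then the inner vertices along the path, then the apex. When inner
  -- vertex i is reached, at most i + 1 and the apex remain as neighbours, and these are adjacent if
  -- i + 1 is inner.
  refine isChordal_of_elimination
    (fun v => if v.val = 0 then 0 else if v.val = k then 1 else v.val + 1) ?_
  intro v x y hx hy hvx hvy hxy
  rw [pathWithApex_adj] at *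
  rw [Ne, Fin.ext_iff] at hxy
  have := v.2
  have := x.2
  have := y.2
  split_ifs at * <;> omega

theorem not_isMPartitionable_pathWithApex {k : ℕ} (hk : Odd k) (h5 : 5 ≤ k) :
    ¬ IsMPartitionable M₁ (pathWithApex k) := by
  rintro ⟨c, hc⟩
  rw [isMPartition_M₁_iff] at hc
  obtain ⟨d, hd⟩ : ∃ d : ℕ → ℕ, ∀ i : Fin (k + 2), d i = (c i).val :=
    ⟨fun i => if h : i < k + 2 then (c ⟨i, h⟩).val else 0, fun i => by simp⟩
  have hlt : ∀ i < k + 2, d i < 3 := fun i hi => by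
    rw [hd ⟨i, hi⟩]
    exact (c _).2
  have hadj : ∀ i j, i < j → (j ≤ k ∧ j = i + 1) ∨ (0 < i ∧ i < k ∧ j = k + 1) → d i ≠ d j := by
    intro i j hij h
    have := (hc ⟨i, by omega⟩ ⟨j, by omega⟩ (by simpa using hij.ne)).1
      (by rw [pathWithApex_adj]; dsimp only; omega)
    rwa [hd ⟨i, by omega⟩, hd ⟨j, by omega⟩, Ne, ← Fin.ext_iff]
  have hnadj : ∀ i j, i + 1 < j → (j ≤ k ∨ (j = k + 1 ∧ (i = 0 ∨ i = k))) →
      d i = d j ∨ d i = 0 ∨ d j = 0 := by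
    intro i j hij h
    have := (hc ⟨i, by omega⟩ ⟨j, by omega⟩ (by simp; omega)).2
      (by rw [pathWithApex_adj]; dsimp only; omega)
    rw [hd ⟨i, by omega⟩, hd ⟨j, by omega⟩]
    rcases this with h | h | h <;> simp [h]
  have hend : d k = d (k + 1) ∨ d k = 0 ∨ d (k + 1) = 0 := by
    have := (hc ⟨k, by omega⟩ ⟨k + 1, by omega⟩ (by simp)).2
      (by rw [pathWithApex_adj]; dsimp only; omega)
    rw [hd ⟨k, by omega⟩, hd ⟨k + 1, by omega⟩]
    rcases this with h | h | h <;> simp [h]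
  have hz := hlt (k + 1) (by omega)
  have hapex : ∀ i, 0 < i → i < k → d i ≠ d (k + 1) := fun i h1 h2 =>
    hadj i _ (by omega) (Or.inr ⟨h1, h2, rfl⟩)
  have hpath : ∀ i j, j = i + 1 → j ≤ k → d i ≠ d j := fun i j h1 h2 =>
    hadj i j (by omega) (Or.inl ⟨h2, h1⟩)
  -- If the apex had colour 0, vertices 1, 2, 3, 4, inner because `k ≥ 5`, would alternate between 1
  -- and 2, giving the non-adjacent 1 and 4 different nonzero colours.
  have hz0 : d (k + 1) ≠ 0 := by
    intro h0
    have := hlt 1 (by omega)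
    have := hlt 2 (by omega)
    have := hlt 3 (by omega)
    have := hlt 4 (by omega)
    have := hapex 1 (by omega) (by omega)
    have := hapex 2 (by omega) (by omega)
    have := hapex 3 (by omega) (by omega)
    have := hapex 4 (by omega) (by omega)
    have := hpath 1 2 rfl (by omega)
    have := hpath 2 3 rfl (by omega)
    have := hpath 3 4 rfl (by omega)
    have := hnadj 1 4 (by omega) (by omega)
    omega
  -- One of 2, 3 carries the nonzero colour different from the apex's. Vertex 0 is adjacent neither
  -- to it nor to the apex, so only colour 0 is left; the other endpoint is symmetric.
  have h0 : d 0 = 0 := by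
    have := hlt 2 (by omega)
    have := hlt 3 (by omega)
    have := hapex 2 (by omega) (by omega)
    have := hapex 3 (by omega) (by omega)
    have := hpath 2 3 rfl (by omega)
    have := hnadj 0 2 (by omega) (by omega)
    have := hnadj 0 3 (by omega) (by omega)
    have := hnadj 0 (k + 1) (by omega) (by omega)
    omega
  obtain ⟨m, rfl⟩ : ∃ m, k = m + 3 := ⟨k - 3, by omega⟩
  have h1 : d (m + 3) = 0 := by
    have := hlt m (by omega)
    have := hlt (m + 1) (by omega)
    have := hapex m (by omega) (by omega)
    have := hapex (m + 1) (by omega) (by omega)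
    have := hpath m (m + 1) rfl (by omega)
    have := hnadj m (m + 3) (by omega) (by omega)
    have := hnadj (m + 1) (m + 3) (by omega) (by omega)
    omega
  -- Inner vertices have only two colours available, so zeros occur exactly at even positions.
  -- Colour 0 at both ends then contradicts the odd length.
  have halt : ∀ i, i < m + 3 → (d i = 0 ↔ i % 2 = 0) := by
    intro i
    induction i with
    | zero => simp [h0]
    | succ i ih =>
      intro hi
      have h2 := ih (by omega)
      have := hlt i (by omega)
      have := hlt (i + 1) (by omega)
      have := hpath i (i + 1) rfl (by omega)
      have := hapex (i + 1) (by omega) hi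
      rcases Nat.eq_zero_or_pos i with rfl | h3
      · omega
      · have := hapex i h3 (by omega)
        omega
  have h2 := halt (m + 2) (by omega)
  have := hpath (m + 2) (m + 3) rfl (by omega)
  rw [Nat.odd_iff] at hk
  omega

theorem pathWithApex_obstruction {k : ℕ} (hk : Odd k) (h5 : 5 ≤ k) :
    IsChordal (pathWithApex k) ∧ IsMinimalObstruction M₁ (pathWithApex k) := by
  refine ⟨isChordal_pathWithApex k, isMinimalObstruction_of_forall_deletion
    (not_isMPartitionable_pathWithApex hk h5)
    -- The apex is alone in its part; the path alternates 0, 2 starting from each end towards the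
    -- deleted vertex, so both endpoints get 0. If the apex is deleted, a single alternation runs
    -- along the whole path.
    (fun w j => if j.val = k + 1 then 1
      else if j.val < w.val then (if j.val % 2 = 0 then 0 else 2)
      else (if (k - j.val) % 2 = 0 then 0 else 2)) ?_⟩
  intro w u v hu hv huv
  rw [Compatible, pathWithApex_adj]
  rw [Ne, Fin.ext_iff] at hu hv huv
  have := u.2
  have := v.2
  have := w.2
  constructor
  · intro h
    split_ifs <;> first | decide | (exfalso; omega)
  · intro h
    split_ifs <;> first | (simp; done) | (exfalso; omega)

/-- Every member of `ℱ` is a chordal minimal obstruction. -/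
theorem isChordal_and_isMinimalObstruction_of_mem_familyF {H : Σ n : ℕ, SimpleGraph (Fin n)}
    (hH : H ∈ familyF) : IsChordal H.2 ∧ IsMinimalObstruction M₁ H.2 := by
  simp only [familyF, familyOne, Set.mem_union, Set.mem_insert_iff, Set.mem_singleton_iff,
    Set.mem_ofPred_eq] at hH
  rcases hH with (rfl | rfl | rfl | rfl | rfl | rfl | rfl) | ⟨k, hk, h5, rfl⟩
  · exact F₁_obstruction
  · exact F₂_obstruction
  · exact F₃_obstruction
  · exact F₄_obstruction
  · exact F₅_obstruction
  · exact F₆_obstruction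
  · exact F₇_obstruction
  · exact pathWithApex_obstruction hk h5

/-! ### Excluded configurations as adjacency conditions -/

/-- `G` has no induced `C₄` or `C₅`, and none of the sporadic members of `ℱ`. -/
structure AvoidsSporadic {V : Type*} (G : SimpleGraph V) : Prop where
  c4 : ∀ {a b c d}, G.Adj a b → G.Adj b c → G.Adj c d → G.Adj d a → a ≠ c → b ≠ d →
    ¬ G.Adj a c → ¬ G.Adj b d → False
  c5 : ∀ {a b c d e}, G.Adj a b → G.Adj b c → G.Adj c d → G.Adj d e → G.Adj e a →
    ¬ G.Adj a c → ¬ G.Adj a d → ¬ G.Adj b d → ¬ G.Adj b e → ¬ G.Adj c e → False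
  k4 : ∀ {a b c d}, G.Adj a b → G.Adj a c → G.Adj a d → G.Adj b c → G.Adj b d → G.Adj c d → False
  triangle_edge : ∀ {a b c d e}, G.Adj a b → G.Adj b c → G.Adj a c → G.Adj d e →
    ¬ G.Adj a d → ¬ G.Adj a e → ¬ G.Adj b d → ¬ G.Adj b e → ¬ G.Adj c d → ¬ G.Adj c e → False
  net : ∀ {a b c x y z}, G.Adj a b → G.Adj b c → G.Adj a c → G.Adj a x → G.Adj b y → G.Adj c z →
    ¬ G.Adj a y → ¬ G.Adj a z → ¬ G.Adj b x → ¬ G.Adj b z → ¬ G.Adj c x → ¬ G.Adj c y →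
    ¬ G.Adj x y → ¬ G.Adj x z → ¬ G.Adj y z → False
  two_paths : ∀ {a b c d e f g}, G.Adj a b → G.Adj b c → G.Adj a c → G.Adj b d → G.Adj d e →
    G.Adj c f → G.Adj f g → ¬ G.Adj a d → ¬ G.Adj a e → ¬ G.Adj a f → ¬ G.Adj a g →
    ¬ G.Adj b e → ¬ G.Adj b f → ¬ G.Adj b g → ¬ G.Adj c d → ¬ G.Adj c e → ¬ G.Adj c g →
    ¬ G.Adj d f → ¬ G.Adj d g → ¬ G.Adj e f → ¬ G.Adj e g → False
  fan : ∀ {z a b c d x y}, G.Adj a b → G.Adj b c → G.Adj c d → G.Adj z a → G.Adj z b →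
    G.Adj z c → G.Adj z d → G.Adj b x → G.Adj c y → ¬ G.Adj a c → ¬ G.Adj a d → ¬ G.Adj b d →
    ¬ G.Adj x z → ¬ G.Adj x a → ¬ G.Adj x c → ¬ G.Adj x d → ¬ G.Adj x y →
    ¬ G.Adj y z → ¬ G.Adj y a → ¬ G.Adj y b → ¬ G.Adj y d → False
  sun : ∀ {a b c x y z}, G.Adj a b → G.Adj b c → G.Adj a c → G.Adj x a → G.Adj x b →
    G.Adj y b → G.Adj y c → G.Adj z a → G.Adj z c → ¬ G.Adj x c → ¬ G.Adj y a → ¬ G.Adj z b →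
    ¬ G.Adj x y → ¬ G.Adj x z → ¬ G.Adj y z → False
  path_sq : ∀ {a b c d e f}, G.Adj a b → G.Adj b c → G.Adj c d → G.Adj d e → G.Adj e f →
    G.Adj a c → G.Adj b d → G.Adj c e → G.Adj d f → ¬ G.Adj a d → ¬ G.Adj a e → ¬ G.Adj a f →
    ¬ G.Adj b e → ¬ G.Adj b f → ¬ G.Adj c f → False

section Sporadic

variable {V : Type*} {G : SimpleGraph V}

/-- To embed a graph without twins it suffices to respect adjacency. -/
theorem isIndContained_of_adj_iff {n : ℕ} {H : SimpleGraph (Fin n)} (f : Fin n → V)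
    (hH : ∀ i j, i ≠ j → ∃ k, ¬ (H.Adj i k ↔ H.Adj j k))
    (h : ∀ i j, i < j → (G.Adj (f i) (f j) ↔ H.Adj i j)) : H.IsIndContained G := by
  have h' : ∀ i j, G.Adj (f i) (f j) ↔ H.Adj i j := by
    intro i j
    rcases lt_trichotomy i j with h1 | rfl | h1
    · exact h i j h1
    · simp
    · rw [SimpleGraph.adj_comm, SimpleGraph.adj_comm H]
      exact h j i h1
  refine ⟨⟨⟨f, fun i j hij => ?_⟩, fun {i j} => h' i j⟩⟩
  by_contra hne
  obtain ⟨k, hk⟩ := hH i j hne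
  rw [← h', ← h', hij] at hk
  exact hk Iff.rfl

/-- Of these configurations only the 4-cycle has two vertices with equal neighbourhoods, so only
`c4` must ask for distinctness; elsewhere the adjacencies force it. -/
theorem IsChordal.avoidsSporadic (hG : IsChordal G) (hF : IsFree familyF G) :
    AvoidsSporadic G where
  c4 := by
    intro a b c d h1 h2 h3 h4 n1 n2 h5 h6
    have : IsInducedCycleSeq G 4
        (fun i => if i = 0 then a else if i = 1 then b else if i = 2 then c else d) := by
      intro i j hij hj
      interval_cases j <;> interval_cases i <;>
        simp [*, h1.ne, h2.ne, h3.ne, h4.ne', h4.symm]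
    have := hG.eq_three (by norm_num) this
    omega
  c5 := by
    intro a b c d e h1 h2 h3 h4 h5 n1 n2 n3 n4 n5
    have : IsInducedCycleSeq G 5 (fun i => if i = 0 then a else if i = 1 then b else
        if i = 2 then c else if i = 3 then d else e) := by
      intro i j hij hj
      interval_cases j <;> interval_cases i <;>
        simp [*, h1.ne, h2.ne, h3.ne, h4.ne, h5.ne', h5.symm] <;> grind [G.adj_comm]
    have := hG.eq_three (by norm_num) this
    omega
  k4 := by
    intro a b c d h1 h2 h3 h4 h5 h6
    refine hF ⟨4, F₇⟩ (by simp [familyF])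
      (isIndContained_of_adj_iff ![a, b, c, d] (by decide) fun i j hij => ?_)
    fin_cases i <;> fin_cases j <;> first
      | exact absurd hij (by decide)
      | exact iff_of_true (by assumption) (by decide)
  triangle_edge := by
    intro a b c d e h1 h2 h3 h4 n1 n2 n3 n4 n5 n6
    refine hF ⟨5, F₁⟩ (by simp [familyF])
      (isIndContained_of_adj_iff ![a, b, c, d, e] (by decide) fun i j hij => ?_)
    fin_cases i <;> fin_cases j <;> first
      | exact absurd hij (by decide)
      | exact iff_of_true (by assumption) (by decide)
      | exact iff_of_false (by assumption) (by decide)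
  net := by
    intro a b c x y z h1 h2 h3 h4 h5 h6 n1 n2 n3 n4 n5 n6 n7 n8 n9
    refine hF ⟨6, F₂⟩ (by simp [familyF])
      (isIndContained_of_adj_iff ![a, b, c, x, y, z] (by decide) fun i j hij => ?_)
    fin_cases i <;> fin_cases j <;> first
      | exact absurd hij (by decide)
      | exact iff_of_true (by assumption) (by decide)
      | exact iff_of_false (by assumption) (by decide)
  two_paths := by
    intro a b c d e f g h1 h2 h3 h4 h5 h6 h7 n1 n2 n3 n4 n5 n6 n7 n8 n9 n10 n11 n12 n13 n14
    refine hF ⟨7, F₃⟩ (by simp [familyF])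
      (isIndContained_of_adj_iff ![a, b, c, d, e, f, g] (by decide) fun i j hij => ?_)
    fin_cases i <;> fin_cases j <;> first
      | exact absurd hij (by decide)
      | exact iff_of_true (by assumption) (by decide)
      | exact iff_of_false (by assumption) (by decide)
  fan := by
    intro z a b c d x y h1 h2 h3 h4 h5 h6 h7 h8 h9 n1 n2 n3 n4 n5 n6 n7 n8 n9 n10 n11 n12
    refine hF ⟨7, F₄⟩ (by simp [familyF])
      (isIndContained_of_adj_iff ![z, b, c, x, y, d, a] (by decide) fun i j hij => ?_)
    fin_cases i <;> fin_cases j <;> first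
      | exact absurd hij (by decide)
      | exact iff_of_true (by first | assumption | (apply SimpleGraph.Adj.symm; assumption)) (by decide)
      | exact iff_of_false (by first | assumption | (rw [G.adj_comm]; assumption)) (by decide)
  sun := by
    intro a b c x y z h1 h2 h3 h4 h5 h6 h7 h8 h9 n1 n2 n3 n4 n5 n6
    refine hF ⟨6, F₅⟩ (by simp [familyF])
      (isIndContained_of_adj_iff ![x, b, y, c, z, a] (by decide) fun i j hij => ?_)
    fin_cases i <;> fin_cases j <;> first
      | exact absurd hij (by decide)
      | exact iff_of_true (by first | assumption | (apply SimpleGraph.Adj.symm; assumption)) (by decide)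
      | exact iff_of_false (by first | assumption | (rw [G.adj_comm]; assumption)) (by decide)
  path_sq := by
    intro a b c d e f h1 h2 h3 h4 h5 h6 h7 h8 h9 n1 n2 n3 n4 n5 n6
    refine hF ⟨6, F₆⟩ (by simp [familyF])
      (isIndContained_of_adj_iff ![a, b, c, d, e, f] (by decide) fun i j hij => ?_)
    fin_cases i <;> fin_cases j <;> first
      | exact absurd hij (by decide)
      | exact iff_of_true (by assumption) (by decide)
      | exact iff_of_false (by assumption) (by decide)

end Sporadic

/-! ### A good vertex common to all triangles -/

section Core
variable {V : Type*} {G : SimpleGraph V}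

/-- `x`, `y`, `z` are the vertices of a triangle. -/
def IsTriangle (G : SimpleGraph V) (x y z : V) : Prop := G.Adj x y ∧ G.Adj y z ∧ G.Adj x z

/-- `v` lies in every triangle. -/
def MeetsTriangles (G : SimpleGraph V) (v : V) : Prop :=
  ∀ x y z, IsTriangle G x y z → v = x ∨ v = y ∨ v = z

/-- Some edge avoids `v` and all of its neighbours. -/
def HasFarEdge (G : SimpleGraph V) (v : V) : Prop :=
  ∃ d e, G.Adj d e ∧ d ≠ v ∧ e ≠ v ∧ ¬ G.Adj v d ∧ ¬ G.Adj v e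

/-- The vertices form an induced bull, with nose `v`, triangle `v`, `p`, `q` and pendant vertices
`p'`, `q'` attached to `p` and `q`. -/
structure IsBull (G : SimpleGraph V) (v p q p' q' : V) : Prop where
  vp : G.Adj v p
  vq : G.Adj v q
  pq : G.Adj p q
  pp' : G.Adj p p'
  qq' : G.Adj q q'
  vp' : ¬ G.Adj v p'
  vq' : ¬ G.Adj v q'
  pq' : ¬ G.Adj p q'
  qp' : ¬ G.Adj q p'
  p'q' : ¬ G.Adj p' q'

theorem IsBull.swap {v p q p' q' : V} (h : IsBull G v p q p' q') : IsBull G v q p q' p' :=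
  ⟨h.vq, h.vp, h.pq.symm, h.qq', h.pp', h.vq', h.vp', h.qp', h.pq', fun k => h.p'q' k.symm⟩

theorem IsTriangle.rotate {x y z : V} (h : IsTriangle G x y z) : IsTriangle G y z x :=
  ⟨h.2.1, h.2.2.symm, h.1.symm⟩

theorem IsTriangle.swap {x y z : V} (h : IsTriangle G x y z) : IsTriangle G x z y :=
  ⟨h.2.2, h.2.1.symm, h.1⟩

namespace AvoidsSporadic

/-- By $K_4$ and $C_4$, c has no neighbour among x, y, z. If y or z is adjacent to a or b, the six
vertices form $P_6^2$; otherwise a, b, c and the edge yz form $F_1$. -/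
theorem false_of_disjoint_of_adj_two (h : AvoidsSporadic G) {a b c x y z : V}
    (ht : IsTriangle G a b c) (hs : IsTriangle G x y z) (hcx : c ≠ x) (hay : a ≠ y) (hby : b ≠ y)
    (haz : a ≠ z) (hbz : b ≠ z) (hxa : G.Adj x a) (hxb : G.Adj x b) :
    False := by
  obtain ⟨ab, bc, ac⟩ := ht
  obtain ⟨xy, yz, xz⟩ := hs
  have hxc : ¬ G.Adj x c := fun k => h.k4 ab ac hxa.symm bc hxb.symm k.symm
  have key : ∀ w, G.Adj x w → a ≠ w → b ≠ w → ¬ G.Adj c w := by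
    intro w hw n1 n2 k
    have h1 : G.Adj a w := by
      by_contra h1
      exact h.c4 hxa ac k hw.symm hcx.symm n1 hxc h1
    have h2 : G.Adj b w := by
      by_contra h1
      exact h.c4 hxb bc k hw.symm hcx.symm n2 hxc h1
    exact h.k4 ab hxa.symm h1 hxb.symm h2 hw
  have hcy' := key y xy hay hby
  have hcz' := key z xz haz hbz
  have main : ∀ a b y z, G.Adj a b → G.Adj b c → G.Adj a c → G.Adj x a → G.Adj x b →
      G.Adj x y → G.Adj y z → G.Adj x z → a ≠ z → b ≠ y → ¬ G.Adj c y → ¬ G.Adj c z →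
      G.Adj y a → False := by
    intro a b y z ab bc ac xa xb xy yz xz n1 n2 cy cz ya
    have yb : ¬ G.Adj y b := fun k => h.k4 ab xa.symm ya.symm xb.symm k.symm xy
    have za : ¬ G.Adj z a := fun k => h.k4 xa xy xz ya.symm k.symm yz
    have zb : ¬ G.Adj z b := fun k =>
      h.c4 k ab.symm ya.symm yz n1.symm n2 za (fun k => yb k.symm)
    exact h.path_sq bc.symm ab.symm xa.symm xy yz ac.symm xb.symm ya.symm xz
      (fun k => hxc k.symm) cy cz (fun k => yb k.symm) (fun k => zb k.symm) (fun k => za k.symm)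
  by_cases h1 : G.Adj y a
  · exact main a b y z ab bc ac hxa hxb xy yz xz haz hby hcy' hcz' h1
  by_cases h2 : G.Adj y b
  · exact main b a y z ab.symm ac bc hxb hxa xy yz xz hbz hay hcy' hcz' h2
  by_cases h3 : G.Adj z a
  · exact main a b z y ab bc ac hxa hxb xz yz.symm xy hay hbz hcz' hcy' h3
  by_cases h4 : G.Adj z b
  · exact main b a z y ab.symm ac bc hxb hxa xz yz.symm xy hby haz hcz' hcy' h4
  exact h.triangle_edge ab bc ac yz (fun k => h1 k.symm) (fun k => h3 k.symm)
    (fun k => h2 k.symm) (fun k => h4 k.symm) hcy' hcz'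

/-- By the two-neighbour case, xa is the only edge between the triangles at x or at a. An edge from
y or z to b or c would close an induced 4-cycle through xa, so a, b, c and yz form $F_1$. -/
theorem false_of_disjoint_of_adj (h : AvoidsSporadic G) {a b c x y z : V}
    (ht : IsTriangle G a b c) (hs : IsTriangle G x y z) (hbx : b ≠ x) (hcx : c ≠ x) (hay : a ≠ y)
    (hby : b ≠ y) (hcy : c ≠ y) (haz : a ≠ z) (hbz : b ≠ z) (hcz : c ≠ z) (hxa : G.Adj x a) :
    False := by
  have hxb : ¬ G.Adj x b := h.false_of_disjoint_of_adj_two ht hs hcx hay hby haz hbz hxa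
  have hxc : ¬ G.Adj x c :=
    h.false_of_disjoint_of_adj_two ht.swap hs hbx hay hcy haz hcz hxa
  have hay' : ¬ G.Adj a y := h.false_of_disjoint_of_adj_two hs ht haz.symm hbx.symm hby.symm
    hcx.symm hcy.symm hxa.symm
  have haz' : ¬ G.Adj a z := h.false_of_disjoint_of_adj_two hs.swap ht hay.symm hbx.symm hbz.symm
    hcx.symm hcz.symm hxa.symm
  obtain ⟨ab, bc, ac⟩ := ht
  obtain ⟨xy, yz, xz⟩ := hs
  refine h.triangle_edge ab bc ac yz hay' haz' ?_ ?_ ?_ ?_ <;> intro k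
  · exact h.c4 hxa ab k xy.symm hbx.symm hay hxb hay'
  · exact h.c4 hxa ab k xz.symm hbx.symm haz hxb haz'
  · exact h.c4 hxa ac k xy.symm hcx.symm hay hxc hay'
  · exact h.c4 hxa ac k xz.symm hcx.symm haz hxc haz'

/-- Any two triangles have a common vertex. -/
theorem triangles_meet (h : AvoidsSporadic G) {a b c x y z : V} (ht : IsTriangle G a b c)
    (hs : IsTriangle G x y z) :
    (a = x ∨ a = y ∨ a = z) ∨ (b = x ∨ b = y ∨ b = z) ∨ (c = x ∨ c = y ∨ c = z) := by
  by_contra hne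
  push Not at hne
  obtain ⟨⟨n1, n2, n3⟩, ⟨n4, n5, n6⟩, n7, n8, n9⟩ := hne
  have key : ∀ a b c, IsTriangle G a b c → a ≠ x → b ≠ x → c ≠ x → a ≠ y → b ≠ y → c ≠ y →
      a ≠ z → b ≠ z → c ≠ z → ¬ G.Adj a x ∧ ¬ G.Adj a y := by
    intro a b c ht n1 n4 n7 n2 n5 n8 n3 n6 n9
    exact ⟨fun k => h.false_of_disjoint_of_adj ht hs n4 n7 n2 n5 n8 n3 n6 n9 k.symm,
      fun k => h.false_of_disjoint_of_adj ht hs.rotate n5 n8 n3 n6 n9 n1 n4 n7 k.symm⟩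
  have h1 := key a b c ht n1 n4 n7 n2 n5 n8 n3 n6 n9
  have h2 := key b c a ht.rotate n4 n7 n1 n5 n8 n2 n6 n9 n3
  have h3 := key c a b ht.rotate.rotate n7 n1 n4 n8 n2 n5 n9 n3 n6
  exact h.triangle_edge ht.1 ht.2.1 ht.2.2 hs.1 h1.1 h1.2 h2.1 h2.2 h3.1 h3.2

/-- The vertices c, y, r sit on the three sides of the triangle a, b, x and form a 3-sun with it;
any further edge gives $K_4$ or $C_4$. -/
theorem false_of_three_triangles (h : AvoidsSporadic G) {a b c x y r : V}
    (h1 : IsTriangle G a b c) (h2 : IsTriangle G b x y) (hcx : c ≠ x) (hay : a ≠ y)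
    (hax : G.Adj a x) (hra : G.Adj r a) (hrx : G.Adj r x) (hrb : r ≠ b) : False := by
  obtain ⟨ab, bc, ac⟩ := h1
  obtain ⟨bx, xy, by'⟩ := h2
  have cx : ¬ G.Adj c x := fun k => h.k4 ab ac hax bc bx k
  have ya : ¬ G.Adj y a := fun k => h.k4 ab hax k.symm bx by' xy
  have rb : ¬ G.Adj r b := fun k => h.k4 ab hax hra.symm bx k.symm hrx.symm
  have hrc : r ≠ c := fun k => cx (k ▸ hrx)
  have hry : r ≠ y := fun k => ya (k ▸ hra)
  refine h.sun ab bx hax ac.symm bc.symm by'.symm xy.symm hra hrx cx ya rb ?_ ?_ ?_ <;> intro k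
  · exact h.c4 k xy.symm hax.symm ac hcx hay.symm cx ya
  · exact h.c4 k hrx bx.symm bc hcx hrb cx rb
  · exact h.c4 k hra ab by' hay.symm hrb ya rb

/-- The common vertex of two triangles meeting in just one vertex lies in all triangles. -/
theorem meetsTriangles_of_bowtie (h : AvoidsSporadic G) {a b c x y : V}
    (h1 : IsTriangle G a b c) (h2 : IsTriangle G b x y) (hax : a ≠ x) (hay : a ≠ y) (hcx : c ≠ x)
    (hcy : c ≠ y) : MeetsTriangles G b := by
  intro p q r ht
  by_contra hne
  push Not at hne
  -- A triangle missing b must meet both given triangles elsewhere, so it contains one of a, c and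
  -- one of x, y.
  have key : ∀ u w s, IsTriangle G u w s → b ≠ s → (u = a ∨ u = c) → (w = x ∨ w = y) → False := by
    rintro u w s ⟨uw, ws, us⟩ hs (rfl | rfl) (rfl | rfl)
    · exact h.false_of_three_triangles h1 h2 hcx hay uw us.symm ws.symm hs.symm
    · exact h.false_of_three_triangles h1 h2.swap hcy hax uw us.symm ws.symm hs.symm
    · exact h.false_of_three_triangles h1.rotate.swap.rotate.rotate h2 hax hcy uw us.symm
        ws.symm hs.symm
    · exact h.false_of_three_triangles h1.rotate.swap.rotate.rotate h2.swap hay hcx uw us.symm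
        ws.symm hs.symm
  have m1 := h.triangles_meet ht h1
  have m2 := h.triangles_meet ht h2
  have k1 := key p q r ht hne.2.2
  have k2 := key q p r ht.rotate.swap hne.2.2
  have k3 := key q r p ht.rotate hne.1
  have k4 := key r q p ht.rotate.rotate.swap hne.1
  have k5 := key r p q ht.rotate.rotate hne.2.1
  have k6 := key p r q ht.swap hne.2.1
  grind

/-- A triangle missing a meets a, b, c. If it contained just one of b, c, that vertex would be the
centre of a bowtie, hence common to all triangles. So it contains both, and x is its third vertex.
-/
theorem exists_of_triangle_avoiding (h : AvoidsSporadic G) {a b c : V} (ht : IsTriangle G a b c)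
    (ha : ¬ MeetsTriangles G a) (hb : ¬ MeetsTriangles G b) (hc : ¬ MeetsTriangles G c) :
    ∃ x, x ≠ a ∧ G.Adj x b ∧ G.Adj x c := by
  simp only [MeetsTriangles, not_forall] at ha
  obtain ⟨x, y, z, hs, hne⟩ := ha
  push Not at hne
  by_contra hno
  push Not at hno
  have key : ∀ x y z, IsTriangle G x y z → a ≠ y → a ≠ z → b = x → False := by
    rintro x y z hs n1 n2 rfl
    have h1 : c ≠ y := by
      rintro rfl
      exact hno z n2.symm hs.2.2.symm hs.2.1.symm
    have h2 : c ≠ z := by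
      rintro rfl
      exact hno y n1.symm hs.1.symm hs.2.1
    exact hb (h.meetsTriangles_of_bowtie ht hs n1 n2 h1 h2)
  have key' : ∀ x y z, IsTriangle G x y z → a ≠ y → a ≠ z → c = x → False := by
    rintro x y z hs n1 n2 rfl
    have h1 : b ≠ y := by
      rintro rfl
      exact hno z n2.symm hs.2.1.symm hs.2.2.symm
    have h2 : b ≠ z := by
      rintro rfl
      exact hno y n1.symm hs.2.1 hs.1.symm
    exact hc (h.meetsTriangles_of_bowtie ht.swap hs n1 n2 h1 h2)
  have m := h.triangles_meet ht hs
  have k1 := key x y z hs hne.2.1 hne.2.2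
  have k2 := key y z x hs.rotate hne.2.2 hne.1
  have k3 := key z x y hs.rotate.rotate hne.1 hne.2.1
  have k4 := key' x y z hs hne.2.1 hne.2.2
  have k5 := key' y z x hs.rotate hne.2.2 hne.1
  have k6 := key' z x y hs.rotate.rotate hne.1 hne.2.1
  grind

/-- All triangles have a common vertex. -/
theorem exists_meetsTriangles (h : AvoidsSporadic G) {a b c : V} (ht : IsTriangle G a b c) :
    ∃ v, MeetsTriangles G v := by
  by_contra hno
  push Not at hno
  obtain ⟨x, hx, xb, xc⟩ := h.exists_of_triangle_avoiding ht (hno a) (hno b) (hno c)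
  obtain ⟨y, hy, yc, ya⟩ := h.exists_of_triangle_avoiding ht.rotate (hno b) (hno c) (hno a)
  -- If x = y this is a $K_4$; otherwise the triangles b, c, x and a, c, y form a bowtie centred at
  -- c.
  by_cases hxy : x = y
  · subst hxy
    exact h.k4 ht.1 ht.2.2 ya.symm ht.2.1 xb.symm xc.symm
  · exact hno c (h.meetsTriangles_of_bowtie (a := b) (c := x) (x := a) (y := y)
      ⟨ht.2.1, xc.symm, xb.symm⟩ ⟨ht.2.2.symm, ya.symm, yc.symm⟩ ht.1.ne' hy.symm hx hxy)

/-- If an edge `d e` avoids the neighbourhood of the vertex `v` common to all triangles, then every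
triangle at `v` has a pendant path `u d e` (or `u e d`) at another of its vertices. -/
theorem exists_pendant_path (h : AvoidsSporadic G) {v a b d e : V} (hv : MeetsTriangles G v)
    (ht : IsTriangle G v a b) (hde : G.Adj d e) (hd : d ≠ v) (he : e ≠ v) (hvd : ¬ G.Adj v d)
    (hve : ¬ G.Adj v e) :
    ∃ u w d' e', (u = a ∧ w = b ∨ u = b ∧ w = a) ∧ (d' = d ∧ e' = e ∨ d' = e ∧ e' = d) ∧
      G.Adj u d' ∧ ¬ G.Adj u e' ∧ ¬ G.Adj w d' ∧ ¬ G.Adj w e' := by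
  obtain ⟨va, ab, vb⟩ := ht
  have key : ∀ a b d e, G.Adj v a → G.Adj v b → G.Adj a b → G.Adj d e → d ≠ v → e ≠ v →
      ¬ G.Adj v d → ¬ G.Adj v e → G.Adj a d → ¬ G.Adj a e ∧ ¬ G.Adj b d ∧ ¬ G.Adj b e := by
    intro a b d e va vb ab de hd he hvd hve ad
    have h1 : ¬ G.Adj a e := fun k => by
      have := hv a d e ⟨ad, de, k⟩
      grind [va.ne]
    have h2 : ¬ G.Adj b d := fun k => by
      have := hv a b d ⟨ab, k, ad⟩
      grind [va.ne, vb.ne]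
    refine ⟨h1, h2, fun k => ?_⟩
    exact h.c4 ad de k.symm ab.symm (fun k => hve (k ▸ va)) (fun k => hvd (k ▸ vb)) h1
      (fun k => h2 k.symm)
  by_cases h1 : G.Adj a d
  · exact ⟨a, b, d, e, by simp, by simp, h1, key a b d e va vb ab hde hd he hvd hve h1⟩
  by_cases h2 : G.Adj a e
  · exact ⟨a, b, e, d, by simp, by simp, h2, key a b e d va vb ab hde.symm he hd hve hvd h2⟩
  by_cases h3 : G.Adj b d
  · exact ⟨b, a, d, e, by simp, by simp, h3, key b a d e vb va ab.symm hde hd he hvd hve h3⟩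
  by_cases h4 : G.Adj b e
  · exact ⟨b, a, e, d, by simp, by simp, h4,
      key b a e d vb va ab.symm hde.symm he hd hve hvd h4⟩
  exact (h.triangle_edge va ab vb hde hvd hve h1 h2 h3 h4).elim

/-- A triangle at v missing a has its own pendant path to the edge de, from a vertex u. Then v, a, u
and one or both of d, e form an induced $C_4$ or $C_5$, unless the edge au creates a triangle
missing v or another induced $C_4$. -/
theorem meetsTriangles_of_pendant_path (h : AvoidsSporadic G) {v a d e : V}
    (hv : MeetsTriangles G v) (va : G.Adj v a) (hde : G.Adj d e) (hd : d ≠ v) (he : e ≠ v)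
    (hvd : ¬ G.Adj v d) (hve : ¬ G.Adj v e) (had : G.Adj a d) (hae : ¬ G.Adj a e) :
    MeetsTriangles G a := by
  have key : ∀ x y, IsTriangle G v x y → a ≠ x → a ≠ y → False := by
    intro x y ht n1 n2
    obtain ⟨u, w, d', e', hu, hde', h1, h2, -, -⟩ :=
      h.exists_pendant_path hv ht hde hd he hvd hve
    have vu : G.Adj v u := by
      rcases hu with ⟨rfl, -⟩ | ⟨rfl, -⟩
      exacts [ht.1, ht.2.2]
    have hau : a ≠ u := by grind
    have hvu := vu.ne
    have hva := va.ne
    have au : ∀ z, z ≠ v → G.Adj a z → G.Adj u z → ¬ G.Adj a u := by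
      intro z hz k1 k2 k3
      have := hv a u z ⟨k3, k2, k1⟩
      grind
    rcases hde' with ⟨rfl, rfl⟩ | ⟨rfl, rfl⟩
    · exact h.c4 va had h1.symm vu.symm hd.symm hau hvd (au _ hd had h1)
    · have nau : ¬ G.Adj a u := fun k =>
        h.c4 k h1 hde.symm had.symm (by rintro rfl; exact hve va) (fun k => hvd (k ▸ vu)) hae
          h2
      exact h.c5 va had hde h1.symm vu.symm hvd hve hae nau (fun k => h2 k.symm)
  intro x y z ht
  by_contra hne
  push Not at hne
  rcases hv x y z ht with rfl | rfl | rfl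
  · exact key y z ht hne.2.1 hne.2.2
  · exact key z x ht.rotate hne.2.2 hne.1
  · exact key x y ht.rotate.rotate hne.1 hne.2.1

/-- This is $F_3$ once the two paths have no edge between them: such an edge closes an induced $C_4$
or $C_5$, or, for eg, gives $F_1$ with the triangle. -/
theorem false_of_two_pendant_paths (h : AvoidsSporadic G) {p q r d e f g : V}
    (ht : IsTriangle G p q r) (qd : G.Adj q d) (de : G.Adj d e) (rf : G.Adj r f)
    (fg : G.Adj f g) (pd : ¬ G.Adj p d) (pe : ¬ G.Adj p e) (rd : ¬ G.Adj r d) (re : ¬ G.Adj r e)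
    (qe : ¬ G.Adj q e) (pf : ¬ G.Adj p f) (pg : ¬ G.Adj p g) (qf : ¬ G.Adj q f)
    (qg : ¬ G.Adj q g) (rg : ¬ G.Adj r g) : False := by
  obtain ⟨pq, qr, pr⟩ := ht
  have df : ¬ G.Adj d f := fun k =>
    h.c4 qd k rf.symm qr.symm (by rintro rfl; exact pf pq) (by rintro rfl; exact pd pr) qf
      (fun k => rd k.symm)
  have dg : ¬ G.Adj d g := fun k =>
    h.c5 qd k fg.symm rf.symm qr.symm qg qf df (fun k => rd k.symm) (fun k => rg k.symm)
  have ef : ¬ G.Adj e f := fun k =>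
    h.c5 qd de k rf.symm qr.symm qe qf df (fun k => rd k.symm) (fun k => re k.symm)
  have eg : ¬ G.Adj e g := fun k => h.triangle_edge pq qr pr k pe pg qe qg re rg
  exact h.two_paths pq qr pr qd de rf fg pd pe pf pg qe qf qg rd re rg df dg ef eg

/-- A far edge of one common vertex of the triangles yields another common vertex without far edge
and without bull. -/
theorem exists_of_hasFarEdge (h : AvoidsSporadic G) {v x y : V} (hv : MeetsTriangles G v)
    (ht : IsTriangle G v x y) (hE : HasFarEdge G v) :
    ∃ a, MeetsTriangles G a ∧ ¬ HasFarEdge G a ∧ ∀ p q p' q', ¬ IsBull G a p q p' q' := by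
  obtain ⟨d₀, e₀, hde₀, hd₀, he₀, hvd₀, hve₀⟩ := hE
  obtain ⟨a, b, d, e, hab, hde, ad, ae, bd, be⟩ :=
    h.exists_pendant_path hv ht hde₀ hd₀ he₀ hvd₀ hve₀
  have hab : IsTriangle G v a b := by
    rcases hab with ⟨rfl, rfl⟩ | ⟨rfl, rfl⟩
    exacts [ht, ht.swap]
  obtain ⟨de, hd, he, vd, ve⟩ :
      G.Adj d e ∧ d ≠ v ∧ e ≠ v ∧ ¬ G.Adj v d ∧ ¬ G.Adj v e := by
    rcases hde with ⟨rfl, rfl⟩ | ⟨rfl, rfl⟩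
    exacts [⟨hde₀, hd₀, he₀, hvd₀, hve₀⟩, ⟨hde₀.symm, he₀, hd₀, hve₀, hvd₀⟩]
  have ha := h.meetsTriangles_of_pendant_path hv hab.1 de hd he vd ve ad ae
  refine ⟨a, ha, ?_, ?_⟩
  -- A far edge of a hangs by a pendant path from v or b, giving $F_3$ together with the path a, d,
  -- e.
  · rintro ⟨f₀, g₀, hfg, hf₀, hg₀, haf, hag⟩
    obtain ⟨u, w, f, g, huw, hfg', uf, ug, wf, wg⟩ :=
      h.exists_pendant_path ha hab.rotate.swap hfg hf₀ hg₀ haf hag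
    obtain ⟨fg, af, ag⟩ : G.Adj f g ∧ ¬ G.Adj a f ∧ ¬ G.Adj a g := by
      rcases hfg' with ⟨rfl, rfl⟩ | ⟨rfl, rfl⟩
      exacts [⟨hfg, haf, hag⟩, ⟨hfg.symm, hag, haf⟩]
    rcases huw with ⟨rfl, rfl⟩ | ⟨rfl, rfl⟩
    · exact h.false_of_two_pendant_paths hab.rotate.rotate.swap ad de uf fg bd be vd ve ae wf wg af ag ug
    · exact h.false_of_two_pendant_paths hab ad de uf fg vd ve bd be ae wf wg af ag ug
  -- The triangle of a bull with nose a contains v, so v is one of its sides; the pendant d at a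
  -- completes the bull to a net.
  · have key : ∀ q p' q', IsBull G a v q p' q' → False := by
      intro q p' q' k
      have hvq : v ≠ q := k.pq.ne
      have qd : ¬ G.Adj q d := fun k' => by
        have := hv a q d ⟨k.vq, k', ad⟩
        grind [hab.1.ne]
      refine h.net k.vp k.pq k.vq ad k.pp' k.qq' k.vp' k.vq' vd k.pq' qd k.qp' ?_ ?_ k.p'q'
      · intro k'
        exact h.c4 ad k' k.pp'.symm k.vp.symm (by rintro rfl; exact k.qp' k.vq.symm) hd
          k.vp' (fun k => vd k.symm)
      · intro k'
        exact h.c4 ad k' k.qq'.symm k.vq.symm (by rintro rfl; exact k.pq' k.vp.symm)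
          (by rintro rfl; exact vd k.pq) k.vq' (fun k => qd k.symm)
    intro p q p' q' k
    rcases hv a p q ⟨k.vp, k.pq, k.vq⟩ with h1 | rfl | rfl
    · exact hab.1.ne h1
    · exact key _ _ _ k
    · exact key _ _ _ k.swap

/-- The second bull supplies a pendant v' at v, which turns the first one into a net. -/
theorem false_of_bull_of_bull (h : AvoidsSporadic G) {v p q p' q' : V} (hp : MeetsTriangles G p)
    (hb : IsBull G v p q p' q') {s v' s' : V} (hb' : IsBull G p v s v' s') : False := by
  have hpv' : p ≠ v' := by
    rintro rfl
    exact hb'.qp' hb'.vq.symm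
  have v'q : ¬ G.Adj q v' := fun k => by
    have := hp v q v' ⟨hb.vq, k, hb'.pp'⟩
    grind [hb.vp.ne, hb.pq.ne]
  refine h.net hb.vp hb.pq hb.vq hb'.pp' hb.pp' hb.qq' hb.vp' hb.vq' hb'.vp' hb.pq' v'q hb.qp'
    ?_ ?_ hb.p'q' <;> intro k
  · exact h.c4 hb'.pp' k hb.pp'.symm hb.vp.symm (by rintro rfl; exact hb.qp' hb.vq.symm)
      hpv'.symm hb.vp' (fun k => hb'.vp' k.symm)
  · exact h.c4 hb'.pp' k hb.qq'.symm hb.vq.symm (by rintro rfl; exact hb.pq' hb.vp.symm)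
      (by rintro rfl; exact hb'.vp' hb.pq) hb.vq' (fun k => v'q k.symm)

/-- Each of x, y is adjacent to p or q, otherwise it is the third pendant of a net. A shared
neighbour gives a triangle missing v; different ones give a 4-cycle whose chords would do so. -/
theorem false_of_bull_of_disjoint (h : AvoidsSporadic G) {v p q p' q' x y : V}
    (hv : MeetsTriangles G v) (hb : IsBull G v p q p' q') (ht : IsTriangle G v x y) (hpx : p ≠ x)
    (hqx : q ≠ x) (hpy : p ≠ y) (hqy : q ≠ y) : False := by
  have hvp := hb.vp.ne
  have hvq := hb.vq.ne
  have hvp' : v ≠ p' := by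
    rintro rfl
    exact hb.qp' hb.vq.symm
  have hvq' : v ≠ q' := by
    rintro rfl
    exact hb.pq' hb.vp.symm
  have hvx := ht.1.ne
  have hvy := ht.2.2.ne
  have key : ∀ x, G.Adj v x → p ≠ x → q ≠ x → G.Adj p x ∨ G.Adj q x := by
    intro x vx n1 n2
    by_contra hno
    push Not at hno
    refine h.net hb.vp hb.pq hb.vq vx hb.pp' hb.qq' hb.vp' hb.vq' hno.1 hb.pq' hno.2 hb.qp'
      ?_ ?_ hb.p'q' <;> intro k
    · exact h.c4 vx k hb.pp'.symm hb.vp.symm hvp' n1.symm hb.vp' (fun k => hno.1 k.symm)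
    · exact h.c4 vx k hb.qq'.symm hb.vq.symm hvq' n2.symm hb.vq' (fun k => hno.2 k.symm)
  have no : ∀ w z s, v ≠ w → v ≠ z → v ≠ s → G.Adj w z → G.Adj z s → ¬ G.Adj w s := by
    intro w z s n1 n2 n3 k1 k2 k3
    have := hv w z s ⟨k1, k2, k3⟩
    grind
  obtain ⟨vx, xy, vy⟩ := ht
  have qp := hb.pq.symm
  rcases key x vx hpx hqx with k1 | k1 <;> rcases key y vy hpy hqy with k2 | k2
  · exact no p x y hvp hvx hvy k1 xy k2
  · exact h.c4 k1 xy k2.symm qp hpy hqx.symm (no p q y hvp hvq hvy hb.pq k2)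
      (no x p q hvx hvp hvq k1.symm hb.pq)
  · exact h.c4 k1 xy k2.symm hb.pq hqy hpx.symm (no q p y hvq hvp hvy qp k2)
      (no x q p hvx hvq hvp k1.symm qp)
  · exact no q x y hvq hvx hvy k1 xy k2

/-- The path x p q y, its apex v and the pendants p', q' form $F_4$; any extra edge yields a
triangle missing v or an induced $C_4$. -/
theorem false_of_bull_of_fan (h : AvoidsSporadic G) {v p q p' q' x y : V}
    (hv : MeetsTriangles G v) (hb : IsBull G v p q p' q') (vx : G.Adj v x) (px : G.Adj p x)
    (hxq : x ≠ q) (vy : G.Adj v y) (qy : G.Adj q y) (hyp : y ≠ p) : False := by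
  have hvp := hb.vp.ne
  have hvq := hb.vq.ne
  have hvx := vx.ne
  have hvy := vy.ne
  have hvp' : v ≠ p' := by
    rintro rfl
    exact hb.qp' hb.vq.symm
  have hvq' : v ≠ q' := by
    rintro rfl
    exact hb.pq' hb.vp.symm
  have no : ∀ w z s, v ≠ w → v ≠ z → v ≠ s → G.Adj w z → G.Adj z s → ¬ G.Adj w s := by
    intro w z s n1 n2 n3 k1 k2 k3
    have := hv w z s ⟨k1, k2, k3⟩
    grind
  have xq : ¬ G.Adj x q := no x p q hvx hvp hvq px.symm hb.pq
  have py : ¬ G.Adj p y := no p q y hvp hvq hvy hb.pq qy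
  have xy : ¬ G.Adj x y := fun k =>
    h.c4 px k qy.symm hb.pq.symm hyp.symm hxq py xq
  refine h.fan px.symm hb.pq qy vx hb.vp hb.vq vy hb.pp' hb.qq' xq xy py
    (fun k => hb.vp' k.symm) ?_ (fun k => hb.qp' k.symm) ?_ hb.p'q' (fun k => hb.vq' k.symm) ?_
    (fun k => hb.pq' k.symm) ?_ <;> intro k
  · exact no p' x p hvp' hvx hvp k px.symm hb.pp'.symm
  · exact h.c4 hb.pp' k qy.symm hb.pq.symm hyp.symm (by rintro rfl; exact hb.vp' hb.vq) py
      (fun k => hb.qp' k.symm)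
  · exact h.c4 hb.qq' k px.symm hb.pq hxq.symm (by rintro rfl; exact hb.vq' hb.vp)
      (fun k => xq k.symm) (fun k => hb.pq' k.symm)
  · exact no q' y q hvq' hvy hvq k qy.symm hb.qq'.symm

/-- If there is a triangle, some vertex lies in all triangles, has no far edge and is not the nose
of an induced bull. -/
theorem exists_centre (h : AvoidsSporadic G) {a b c : V} (ht : IsTriangle G a b c) :
    ∃ v, MeetsTriangles G v ∧ ¬ HasFarEdge G v ∧ ∀ p q p' q', ¬ IsBull G v p q p' q' := by
  by_contra hno
  push Not at hno
  have hfar : ∀ v, MeetsTriangles G v → ¬ HasFarEdge G v := by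
    intro v hv hE
    obtain ⟨x, y, hxy⟩ : ∃ x y, IsTriangle G v x y := by
      rcases hv a b c ht with rfl | rfl | rfl
      exacts [⟨_, _, ht⟩, ⟨_, _, ht.rotate⟩, ⟨_, _, ht.rotate.rotate⟩]
    obtain ⟨u, hu, hu', hb⟩ := h.exists_of_hasFarEdge hv hxy hE
    obtain ⟨p, q, p', q', hpq⟩ := hno u hu hu'
    exact hb p q p' q' hpq
  have hbull : ∀ v, MeetsTriangles G v → ∃ p q p' q', IsBull G v p q p' q' :=
    fun v hv => hno v hv (hfar v hv)
  obtain ⟨v, hv⟩ := h.exists_meetsTriangles ht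
  obtain ⟨p, q, p', q', hb⟩ := hbull v hv
  -- The side p cannot be common to all triangles: it would be the nose of a bull having v as a
  -- side. So some triangle, necessarily through v, misses p.
  have key : ∀ p q p' q', IsBull G v p q p' q' → ∃ x y, IsTriangle G v x y ∧ p ≠ x ∧ p ≠ y := by
    intro p q p' q' hb
    have hp : ¬ MeetsTriangles G p := by
      intro hp
      obtain ⟨r, s, r', s', hb'⟩ := hbull p hp
      rcases hv p r s ⟨hb'.vp, hb'.pq, hb'.vq⟩ with h1 | rfl | rfl
      · exact hb.vp.ne h1
      · exact h.false_of_bull_of_bull hp hb hb'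
      · exact h.false_of_bull_of_bull hp hb hb'.swap
    simp only [MeetsTriangles, not_forall] at hp
    obtain ⟨x, y, z, hs, hne⟩ := hp
    push Not at hne
    rcases hv x y z hs with rfl | rfl | rfl
    exacts [⟨y, z, hs, hne.2⟩, ⟨z, x, hs.rotate, hne.2.2, hne.1⟩,
      ⟨x, y, hs.rotate.rotate, hne.1, hne.2.1⟩]
  obtain ⟨x, y, h1, hpx, hpy⟩ := key p q p' q' hb
  obtain ⟨z, w, h2, hqz, hqw⟩ := key q p q' p' hb.swap
  -- The triangle missing p cannot miss q as well, so its third vertex is the wanted y.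
  obtain ⟨y, vy, qy, hyp⟩ : ∃ y, G.Adj v y ∧ G.Adj q y ∧ y ≠ p := by
    by_cases hqx : q = x
    · subst hqx
      exact ⟨y, h1.2.2, h1.2.1, hpy.symm⟩
    by_cases hqy : q = y
    · subst hqy
      exact ⟨x, h1.1, h1.2.1.symm, hpx.symm⟩
    exact (h.false_of_bull_of_disjoint hv hb h1 hpx hqx hpy hqy).elim
  obtain ⟨x, vx, px, hxq⟩ : ∃ x, G.Adj v x ∧ G.Adj p x ∧ x ≠ q := by
    by_cases hpz : p = z
    · subst hpz
      exact ⟨w, h2.2.2, h2.2.1, hqw.symm⟩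
    by_cases hpw : p = w
    · subst hpw
      exact ⟨z, h2.1, h2.2.1.symm, hqz.symm⟩
    exact (h.false_of_bull_of_disjoint hv hb h2 hpz hqz hpw hqw).elim
  exact h.false_of_bull_of_fan hv hb vx px hxq vy qy hyp

end AvoidsSporadic
end Core

/-! ### Switching at a vertex, and the conclusion -/

section Main

variable {V : Type*} {G : SimpleGraph V}

/-- The graph obtained from `G` by complementing the neighbourhood of `v`. -/
def switchAt (G : SimpleGraph V) (v : V) : SimpleGraph V where
  Adj x y := x ≠ y ∧ (G.Adj x y ↔ x ≠ v ∧ y ≠ v)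
  symm := ⟨fun x y h => ⟨h.1.symm, by rw [G.adj_comm, h.2, and_comm]⟩⟩
  loopless := ⟨fun x h => h.1 rfl⟩

theorem switchAt_adj {v x y : V} (hx : x ≠ v) (hy : y ≠ v) :
    (switchAt G v).Adj x y ↔ G.Adj x y := by
  simp only [switchAt, hx, hy, ne_eq, not_false_eq_true, and_self, iff_true, and_iff_right_iff_imp]
  exact fun h => h.ne

theorem switchAt_adj_left {v y : V} (hy : v ≠ y) : (switchAt G v).Adj v y ↔ ¬ G.Adj v y := by
  simp [switchAt, hy]

theorem isMPartitionable_of_colorable (h : G.Colorable 2) : IsMPartitionable M₁ G := by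
  obtain ⟨c⟩ := h
  refine ⟨fun u => if c u = 0 then 0 else 1, isMPartition_M₁_iff.2 fun u v _ => ?_⟩
  have := fun h : G.Adj u v => c.valid h
  generalize c u = x at *
  generalize c v = y at *
  fin_cases x <;> fin_cases y <;> simp_all [Compatible]

/-- Take v alone as $V_2$, the rest of its colour class as $V_3$ and the other class as $V_1$.
Vertices sharing v's colour are non-adjacent to v after switching, hence adjacent to it in G. -/
theorem isMPartitionable_of_colorable_switchAt {v : V} (h : (switchAt G v).Colorable 2) :
    IsMPartitionable M₁ G := by
  classical
  obtain ⟨c⟩ := h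
  refine ⟨fun u => if u = v then 1 else if c u = c v then 2 else 0,
    isMPartition_M₁_iff.2 fun x y hxy => ?_⟩
  have main : ∀ y, v ≠ y → c v = c y → G.Adj v y := by
    intro y hy he
    by_contra hn
    exact c.valid ((switchAt_adj_left hy).2 hn) he
  by_cases hx : x = v
  · subst hx
    have := main y hxy
    have hy : y ≠ x := hxy.symm
    simp only [if_true, hy, if_false]
    split_ifs with h1
    · exact ⟨fun _ => by decide, fun hn => (hn (this h1.symm)).elim⟩
    · exact ⟨fun _ => by decide, fun _ => by decide⟩
  by_cases hy : y = v
  · subst hy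
    have := main x hxy.symm
    simp only [if_true, hx, if_false]
    split_ifs with h1
    · exact ⟨fun _ => by decide, fun hn => (hn (this h1.symm).symm).elim⟩
    · exact ⟨fun _ => by decide, fun _ => by decide⟩
  · have := fun h : G.Adj x y => c.valid ((switchAt_adj hx hy).2 h)
    simp only [hx, hy, if_false]
    generalize c x = a at *
    generalize c y = b at *
    generalize c v = d at *
    by_cases hG : G.Adj x y
    · have := this hG
      refine ⟨fun _ => ?_, fun hn => (hn hG).elim⟩
      revert this
      clear * -
      revert a b d
      decide
    · refine ⟨fun h => (hG h).elim, fun _ => ?_⟩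
      split_ifs <;> simp

/-- An induced path with `k ≥ 5` edges, `k` odd, whose inner vertices but not its endpoints are
adjacent to `v`, yields a member of the infinite family. -/
theorem pathWithApex_isIndContained {k : ℕ} {v : V} {g : ℕ → V} (hk : 5 ≤ k)
    (hv : ∀ i ≤ k, g i ≠ v ∧ (G.Adj v (g i) ↔ 0 < i ∧ i < k))
    (hg : ∀ i j, i < j → j ≤ k → g i ≠ g j ∧ (G.Adj (g i) (g j) ↔ j = i + 1)) :
    (pathWithApex k).IsIndContained G := by
  have hinj : ∀ i j : Fin (k + 2), i < j →
      (if i.val = k + 1 then v else g i) ≠ (if j.val = k + 1 then v else g j) ∧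
      (G.Adj (if i.val = k + 1 then v else g i) (if j.val = k + 1 then v else g j) ↔
        (pathWithApex k).Adj i j) := by
    intro i j hij
    have hij : i.val < j.val := hij
    have := j.2
    rw [pathWithApex_adj, if_neg (by omega : ¬ i.val = k + 1)]
    split_ifs with hj
    · have := hv i (by omega)
      refine ⟨this.1, (G.adj_comm _ _).trans (this.2.trans ?_)⟩
      omega
    · have := hg i j hij (by omega)
      refine ⟨this.1, this.2.trans ?_⟩
      omega
  refine ⟨⟨⟨fun i => if i.val = k + 1 then v else g i, fun i j hij => ?_⟩, fun {i j} => ?_⟩⟩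
  · rcases lt_trichotomy i j with h | h | h
    · exact ((hinj i j h).1 hij).elim
    · exact h
    · exact ((hinj j i h).1 hij.symm).elim
  · rcases lt_trichotomy i j with h | rfl | h
    · exact (hinj i j h).2
    · simp
    · rw [SimpleGraph.adj_comm (pathWithApex k)]
      exact (G.adj_comm _ _).trans (hinj j i h).2

theorem colorable_switchAt (hG : IsChordal G) (hF : IsFree familyF G) {v : V}
    (hT : MeetsTriangles G v) (hE : ¬ HasFarEdge G v)
    (hB : ∀ p q p' q', ¬ IsBull G v p q p' q') : (switchAt G v).Colorable 2 := by
  by_contra hno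
  obtain ⟨n, g, hodd, hn, hg⟩ := exists_odd_isInducedCycleSeq hno
  by_cases hv : ∃ m < n, g m = v
  · obtain ⟨m, hm, hgm⟩ := hv
    replace hg := hg.rotate hm
    set f : ℕ → V := fun i => g ((i + m) % n)
    have hf0 : f 0 = v := by simp [f, Nat.mod_eq_of_lt hm, hgm]
    have hne : ∀ i, 0 < i → i < n → f i ≠ v := fun i h1 h2 => hf0 ▸ (hg 0 i h1 h2).1.symm
    have hvadj : ∀ i, 0 < i → i < n → (G.Adj v (f i) ↔ 1 < i ∧ i + 1 < n) := by
      intro i h1 h2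
      have h3 := (hg 0 i h1 h2).2
      rw [hf0, switchAt_adj_left (hne i h1 h2).symm] at h3
      rw [← not_iff_not, h3]
      omega
    have hadj : ∀ i j, 0 < i → i < j → j < n → (G.Adj (f i) (f j) ↔ j = i + 1) := by
      intro i j h1 h2 h3
      have h4 := (hg i j h2 h3).2
      rw [switchAt_adj (hne i h1 (by omega)) (hne j (by omega) h3)] at h4
      rw [h4]
      omega
    obtain ⟨t, rfl⟩ := hodd
    obtain rfl | rfl | ht : t = 1 ∨ t = 2 ∨ 3 ≤ t := by omega
    -- Length 3: after undoing the switch, the edge opposite v is far from v.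
    · exact hE ⟨f 1, f 2, (hadj 1 2 (by omega) (by omega) (by omega)).2 rfl,
        hne 1 (by omega) (by omega), hne 2 (by omega) (by omega),
        by simp [hvadj 1 (by omega) (by omega)], by simp [hvadj 2 (by omega) (by omega)]⟩
    -- Length 5: v is adjacent in G to exactly the two middle vertices of the path `f 1`, …, `f 4`,
    -- so it is the nose of a bull.
    · have v1 := hvadj 1 (by omega) (by omega)
      have v2 := hvadj 2 (by omega) (by omega)
      have v3 := hvadj 3 (by omega) (by omega)
      have v4 := hvadj 4 (by omega) (by omega)
      have a12 := hadj 1 2 (by omega) (by omega) (by omega)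
      have a13 := hadj 1 3 (by omega) (by omega) (by omega)
      have a14 := hadj 1 4 (by omega) (by omega) (by omega)
      have a23 := hadj 2 3 (by omega) (by omega) (by omega)
      have a24 := hadj 2 4 (by omega) (by omega) (by omega)
      have a34 := hadj 3 4 (by omega) (by omega) (by omega)
      norm_num at v1 v2 v3 v4 a12 a13 a14 a23 a24 a34
      exact hB (f 2) (f 3) (f 1) (f 4)
        ⟨v2, v3, a23, a12.symm, a34, v1, v4, a24, fun k => a13 k.symm, a14⟩
    -- Length `2 * t + 1 ≥ 7`: the path `f 1`, …, `f (2 * t)` has `2 * t - 1 ≥ 5` edges and v is its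
    -- apex.
    · refine hF ⟨2 * t - 1 + 2, pathWithApex (2 * t - 1)⟩
        (Or.inr ⟨2 * t - 1, ⟨t - 1, by omega⟩, by omega, rfl⟩)
        (pathWithApex_isIndContained (v := v) (g := fun i => f (i + 1)) (by omega) ?_ ?_)
      · intro i hi
        refine ⟨hne _ (by omega) (by omega), (hvadj _ (by omega) (by omega)).trans ?_⟩
        omega
      · intro i j hij hj
        refine ⟨(hg _ _ (by omega) (by omega)).1,
          (hadj _ _ (by omega) (by omega) (by omega)).trans ?_⟩
        omega
  · push Not at hv
    have hg' : IsInducedCycleSeq G n g := fun i j hij hj => by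
      rw [← switchAt_adj (hv i (by omega)) (hv j hj)]
      exact hg i j hij hj
    obtain rfl := hG.eq_three hn hg'
    rcases hT (g 0) (g 1) (g 2) ⟨(hg' 0 1 (by omega) (by omega)).2.2 (by omega),
      (hg' 1 2 (by omega) (by omega)).2.2 (by omega),
      (hg' 0 2 (by omega) (by omega)).2.2 (by omega)⟩ with h | h | h
    exacts [hv 0 (by omega) h.symm, hv 1 (by omega) h.symm, hv 2 (by omega) h.symm]

theorem IsChordal.isMPartitionable (hG : IsChordal G) (hF : IsFree familyF G) :
    IsMPartitionable M₁ G := by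
  by_cases hc : G.Colorable 2
  · exact isMPartitionable_of_colorable hc
  obtain ⟨n, g, -, hn, hg⟩ := exists_odd_isInducedCycleSeq hc
  obtain rfl := hG.eq_three hn hg
  obtain ⟨v, hT, hE, hB⟩ := (hG.avoidsSporadic hF).exists_centre
    (a := g 0) (b := g 1) (c := g 2) ⟨(hg 0 1 (by omega) (by omega)).2.2 (by omega),
      (hg 1 2 (by omega) (by omega)).2.2 (by omega),
      (hg 0 2 (by omega) (by omega)).2.2 (by omega)⟩
  exact isMPartitionable_of_colorable_switchAt (colorable_switchAt hG hF hT hE hB)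

end Main

end MatrixPartition

theorem theorem1 {V : Type*} [Finite V] (G : SimpleGraph V) :
    (MatrixPartition.IsChordal G →
      (MatrixPartition.IsMPartitionable MatrixPartition.M₁ G ↔
        MatrixPartition.IsFree MatrixPartition.familyF G)) ∧
    ((MatrixPartition.IsChordal G ∧
        MatrixPartition.IsMinimalObstruction MatrixPartition.M₁ G) ↔
      ∃ H ∈ MatrixPartition.familyF, Nonempty (G ≃g H.2)) := by
  open MatrixPartition in
  refine ⟨fun hG => ⟨fun hP H hH ⟨f⟩ => ?_, hG.isMPartitionable⟩, ?_, ?_⟩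
  · exact (isChordal_and_isMinimalObstruction_of_mem_familyF hH).2.1 (hP.of_embedding f)
  · rintro ⟨hG, hM⟩
    by_contra hno
    refine hM.1 (hG.isMPartitionable fun H hH hc => hno ⟨H, hH, ?_⟩)
    -- The member found inside G has no partition itself, so by minimality it is all of G.
    exact hM.nonempty_iso (isChordal_and_isMinimalObstruction_of_mem_familyF hH).2.1 hc
  · rintro ⟨H, hH, ⟨e⟩⟩
    have h := isChordal_and_isMinimalObstruction_of_mem_familyF hH
    exact ⟨h.1.of_embedding e.toEmbedding, h.2.of_iso e⟩
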